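/- **Conventions.** For $f\in L^2(\mathbb R^d)$ let $\widehat f(\xi)=\int_{\mathbb R^d} f(x)e^{-i x\cdot\xi}\,dx$ be the Fourier transform (extended to $L^2$ by Plancherel). For $r\ge 0$ let $H^{r}(\mathbb R^d)$ be the Sobolev space of all $f\in L^2(\mathbb R^d)$ with $\|f\|_{H^r}:=(2\pi)^{-d/2}\big(\int|\widehat f(\xi)|^2(1+\|\xi\|_2^2)^r d\xi\big)^{1/2}<\infty$, and let $\nu_2(f)=\sup\{r: f\in H^r(\mathbb R^d)\}$. Functions in $H^r(\mathbb R^d)$ with $r>d/2$ are identified with their continuous representatives. **Refinable function.** Let $\varsigma>s>d/2$ and let $\phi\in H^s(\mathbb R^d)$ be nonnegative with $\nu_2(\phi)>\varsigma$ and $\operatorname{supp}\phi\subseteq[0,M_1]\times\cdots\times[0,M_d]$, all $M_l>0$. Suppose that $\phi$ is refinable: $\widehat\phi(0)=1$ and $\widehat\phi(2\xi)=\widehat a(\xi)\widehat\phi(\xi)$ for all $\xi$, with a $2\pi\mathbb Z^d$-periodic mask symbol $\widehat a$; and that $\widehat a$ has $\kappa+1$ sum rules with $\kappa\in\mathbb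 N_0$, $\kappa+1>\varsigma$, that is, $\widehat a(\xi+2\pi\beta)=O(\|\xi\|_2^{\kappa+1})$ as $\xi\to0$ for every $\beta\in\frac12\mathbb Z^d\setminus\mathbb Z^d$. **Sampling sets.** Let $\Omega\subseteq\mathbb R^d$ be bounded and measurable with $\Omega\cap\mathbb Z^d\ne\emptyset$. For $l=1,\dots,d$ let $L_{l,\min}$ and $L_{l,\max}$ be the minimum and the maximum of $k_l$ over $k\in\Omega\cap\mathbb Z^d$, and suppose that $\Omega\subseteq\prod_{l=1}^d[L_{l,\min},L_{l,\max}]$. For $N\ge1$ put $$\Lambda_{\Omega,N}=\{k\in\mathbb Z^d:\ 2^NL_{l,\min}-M_l\le k_l\le 2^NL_{l,\max},\ l=1,\dots,d\},$$ $$\Xi_{\Omega,N}=\{(k,k',k''):\ k\in\Lambda_{\Omega,N},\ k'=(1+2^{-N})k,\ k''=(1-2^{-N})k\},$$ and suppose that $0\notin\Lambda_{\Omega,N}$ for all $N\ge1$. **Reference waves.** Let $g_N(x)=a_N e^{i\nu_N\|x\|_2}/\|x\|_2$ with $a_N>0$, $\nu_N\in\mathbb R$, $N\ge 1$. For $(k,k',k'')\in\Xi_{\Omega,N}$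 write $x=2^{-N}k$, $x'=2^{-N}k'$, $x''=2^{-N}k''$ and $$\mu=-\Im\big[(g_N(x)-g_N(x'))(\overline{g_N(x)}-\overline{g_N(x'')})\big].$$ Suppose that $(g_N)_{N\ge1}$ is uniformly $\gamma$-admissible with $0<\gamma<\infty$: for all $N\ge1$ and all $(k,k',k'')\in\Xi_{\Omega,N}$ one has $g_N(x)\ne g_N(x')$, $g_N(x)\neq g_N(x'')$, $\mu\ne0$ and $\max\{|g_N(x)-g_N(x')|,|g_N(x)-g_N(x'')|\}/|\mu|\le\gamma$; and the numbers $|g_N(x)|,|g_N(x')|,|g_N(x'')|$ are bounded uniformly over all $N\ge1$ and all triples. **Reconstruction.** For $f:\mathbb R^d\to\mathbb C$ and $y\in\{x,x',x''\}$ let $I_y=|f(y)+g_N(y)|^2$ be the observed intensity. With $c+i\delta=g_N(x)-g_N(x')$ and $h+ie=g_N(x)-g_N(x'')$ $(c,\delta,h,e\in\mathbb R)$ let $\mathring f(2^{-N}k)=R+iJ$, where $$\begin{bmatrix}R\\J\end{bmatrix}=\frac1{2\mu}\begin{bmatrix}e&-\delta\\-h&c\end{bmatrix}\begin{bmatrix}I_x-I_{x'}+|g_N(x')|^2-|g_N(x)|^2\\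 I_x-I_{x''}+|g_N(x'')|^2-|g_N(x)|^2\end{bmatrix}.$$ **Theorem.** There exist $C>0$, independent of $\Omega$, and $\widehat C_1>0$, depending on $\Omega$ (both may depend on $d,s,\varsigma,\kappa,\phi,M_1,\dots,M_d$, but neither depends on $\gamma$, $(g_N)$, $f$ or $N$), such that for all such $\gamma$ and $(g_N)$ the supremum $G:=\sup_{j\ge1}\sup_{x\in\Omega}|g_j(x)|$ is finite and for every $f\in H^s(\mathbb R^d)$ with $\nu_2(f)>\varsigma$ and every $N\ge1$, $$\Big\|f-\sum_{k\in\Lambda_{\Omega,N}}\mathring f(2^{-N}k)\,\phi(2^N\cdot-k)\Big\|_{L^2(\Omega)}\le C\|f\|_{H^\varsigma}2^{-N(\varsigma-s)/2}+\gamma\,\widehat C_1\|f\|_{H^\varsigma}\big(\|f\|_{H^\varsigma}+G\big)2^{-N\zeta},$$ where $\zeta=\min\{1,\varsigma-s\}$. -/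

import Mathlib

open MeasureTheory FourierTransform Asymptotics Topology

noncomputable section

namespace PhaseRetrieval

/-- `ℝᵈ` with the Euclidean norm. -/
abbrev E (d : ℕ) : Type := EuclideanSpace ℝ (Fin d)

variable {d : ℕ}

/-! ### Sobolev spaces -/

open Classical in
/-- The Fourier transform of a square-integrable function, in the normalization
`f̂ ξ = ∫ f x * exp (-i x·ξ) dx` (extended to `L²` by Plancherel). Mathlib's `𝓕` uses
`exp (-2πi x·w)`, so that `f̂ ξ = 𝓕 f (ξ / 2π)`. Outside `L²` the value is a dummy. -/
def fourierL2 (f : E d → ℂ) : E d → ℂ :=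
  if hf : MemLp f 2 volume then
    fun ξ => (𝓕 (hf.toLp f) : Lp ℂ 2 (volume : Measure (E d))) ((2 * Real.pi)⁻¹ • ξ)
  else 0

/-- `f ∈ Hʳ(ℝᵈ)`, for square-integrable functions `f`. For `r ≥ 0` this is the whole of
`Hʳ(ℝᵈ)`, as then `Hʳ(ℝᵈ) ⊆ L²(ℝᵈ)`. -/
def MemSobolev (r : ℝ) (f : E d → ℂ) : Prop :=
  MemLp f 2 volume ∧ Integrable (fun ξ => ‖fourierL2 f ξ‖ ^ 2 * (1 + ‖ξ‖ ^ 2) ^ r) volume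

/-- The norm of `Hʳ(ℝᵈ)`. -/
def sobolevNorm (r : ℝ) (f : E d → ℂ) : ℝ :=
  ((2 * Real.pi) ^ ((d : ℝ) / 2))⁻¹ *
    Real.sqrt (∫ ξ, ‖fourierL2 f ξ‖ ^ 2 * (1 + ‖ξ‖ ^ 2) ^ r)

/-- The Sobolev smoothness exponent `ν₂(f) = sup {r : f ∈ Hʳ(ℝᵈ)}`, possibly `+∞`. -/
def sobolevExponent (f : E d → ℂ) : EReal :=
  ⨆ r ∈ {r : ℝ | MemSobolev r f}, (r : EReal)

/-! ### Refinable functions -/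

/-- The integer point `k`, seen in `ℝᵈ`. -/
def latticePt (k : Fin d → ℤ) : E d := WithLp.toLp 2 fun l => (k l : ℝ)

/-- `φ̂ ξ = ∫ φ x * exp (-i x·ξ) dx`, for an integrable function. -/
def fourierInt (φ : E d → ℂ) (ξ : E d) : ℂ :=
  ∫ x, φ x * Complex.exp (-Complex.I * (inner ℝ x ξ : ℝ))

/-- `φ` is refinable with the `2πℤᵈ`-periodic mask symbol `A`, normalized by `φ̂ 0 = 1`. -/
structure IsRefinable (φ : E d → ℂ) (A : E d → ℂ) : Prop where
  periodic : ∀ (ξ : E d) (m : Fin d → ℤ), A (ξ + (2 * Real.pi) • latticePt m) = A ξ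
  refine : ∀ ξ : E d, fourierInt φ ((2 : ℝ) • ξ) = A ξ * fourierInt φ ξ
  normalized : fourierInt φ 0 = 1

/-- The mask symbol `A` has `n` sum rules: `A (ξ + 2πγ) = O(‖ξ‖ⁿ)` as `ξ → 0` for all
`γ ∈ ½ℤᵈ` that do not lie in `ℤᵈ`. Here `γ = m / 2` with `m` not in `2ℤᵈ`. -/
def HasSumRules (A : E d → ℂ) (n : ℕ) : Prop :=
  ∀ m : Fin d → ℤ, (∃ l, Odd (m l)) →
    (fun ξ : E d => A (ξ + Real.pi • latticePt m)) =O[𝓝 0] (fun ξ : E d => ‖ξ‖ ^ n)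

/-! ### The sampling sets -/

/-- The integer points of `Ω`. -/
def intPoints (Ω : Set (E d)) : Set (Fin d → ℤ) := {k | latticePt k ∈ Ω}

/-- The least `l`-th coordinate of the integer points of `Ω`. -/
def Lmin (Ω : Set (E d)) (l : Fin d) : ℤ := sInf ((fun k : Fin d → ℤ => k l) '' intPoints Ω)

/-- The largest `l`-th coordinate of the integer points of `Ω`. -/
def Lmax (Ω : Set (E d)) (l : Fin d) : ℤ := sSup ((fun k : Fin d → ℤ => k l) '' intPoints Ω)

/-- `Λ_{Ω,N}`, see `mem_Lam`. -/
def Lam (Ω : Set (E d)) (M : Fin d → ℝ) (N : ℕ) : Finset (Fin d → ℤ) :=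
  Finset.Icc (fun l => ⌈(2 : ℝ) ^ N * Lmin Ω l - M l⌉) (fun l => 2 ^ N * Lmax Ω l)

theorem mem_Lam {Ω : Set (E d)} {M : Fin d → ℝ} {N : ℕ} {k : Fin d → ℤ} :
    k ∈ Lam Ω M N ↔
      ∀ l, (2 : ℝ) ^ N * Lmin Ω l - M l ≤ k l ∧ (k l : ℝ) ≤ 2 ^ N * Lmax Ω l := by
  simp only [Lam, Finset.mem_Icc, Pi.le_def, Int.ceil_le, ← forall_and]
  refine forall_congr' fun l => and_congr_right fun _ => ?_
  exact_mod_cast Iff.rfl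

/-- The triples `(k, k', k'')` with `k ∈ Λ_{Ω,N}`, `k' = (1 + 2⁻ᴺ) k` and `k'' = (1 - 2⁻ᴺ) k`. -/
def Xi (Ω : Set (E d)) (M : Fin d → ℝ) (N : ℕ) : Set (E d × E d × E d) :=
  {p | ∃ k ∈ Lam Ω M N, p = (latticePt k, (1 + (1 / 2 : ℝ) ^ N) • latticePt k,
    (1 - (1 / 2 : ℝ) ^ N) • latticePt k)}

/-! ### Reference waves -/

/-- The spherical wave `x ↦ b exp (iν‖x‖) / ‖x‖` (relevant only at points `x ≠ 0`). -/
def sphericalWave (b ν : ℝ) (x : E d) : ℂ :=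
  (b : ℂ) / (‖x‖ : ℂ) * Complex.exp (Complex.I * (ν * ‖x‖ : ℝ))

/-- The determinant `μ = -Im [(g x - g x') (conj (g x) - conj (g x''))]`. -/
def mu (g : E d → ℂ) (x x' x'' : E d) : ℝ :=
  -((g x - g x') * (starRingEnd ℂ (g x) - starRingEnd ℂ (g x''))).im

/-- `g` is `γ`-admissible at level `N` on a set of triples. The admissibility condition bounds a
quotient with denominator `|μ|`, which counts as `+∞` where `μ = 0`. -/
def IsAdmissible (γ : ℝ) (g : E d → ℂ) (N : ℕ) (X : Set (E d × E d × E d)) : Prop :=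
  0 < γ ∧ ∀ k k' k'' : E d, (k, k', k'') ∈ X →
    let x := (1 / 2 : ℝ) ^ N • k
    let x' := (1 / 2 : ℝ) ^ N • k'
    let x'' := (1 / 2 : ℝ) ^ N • k''
    g x ≠ g x' ∧ g x ≠ g x'' ∧ mu g x x' x'' ≠ 0 ∧
      max ‖g x - g x'‖ ‖starRingEnd ℂ (g x) - starRingEnd ℂ (g x'')‖ / |mu g x x' x''| ≤ γ

/-- The sequence `(g N)`, `N ≥ 1`, is uniformly `γ`-admissible on `(X N)`, `N ≥ 1`. -/
def IsUniformlyAdmissible (γ : ℝ) (g : ℕ → E d → ℂ) (X : ℕ → Set (E d × E d × E d)) : Prop :=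
  (∀ N, 1 ≤ N → IsAdmissible γ (g N) N (X N)) ∧
    ∃ B : ℝ, ∀ N, 1 ≤ N → ∀ k k' k'' : E d, (k, k', k'') ∈ X N →
      ‖g N ((1 / 2 : ℝ) ^ N • k)‖ ≤ B ∧ ‖g N ((1 / 2 : ℝ) ^ N • k')‖ ≤ B ∧
        ‖g N ((1 / 2 : ℝ) ^ N • k'')‖ ≤ B

/-! ### The reconstruction -/

/-- The interference intensity `|f + g|²`. -/
def intensity (f g : E d → ℂ) (x : E d) : ℝ := ‖f x + g x‖ ^ 2

/-- The value computed from the intensities `I x`, `I x'`, `I x''` and the known wave `g`: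
the real and imaginary part are
`(2μ)⁻¹ [e, -δ; -h, c] [I x - I x' + |g x'|² - |g x|²; I x - I x'' + |g x''|² - |g x|²]`. -/
def recover (g : E d → ℂ) (I : E d → ℝ) (x x' x'' : E d) : ℂ :=
  let c := (g x - g x').re
  let δ := (g x - g x').im
  let h := (g x - g x'').re
  let e := (g x - g x'').im
  let r₁ := I x - I x' + ‖g x'‖ ^ 2 - ‖g x‖ ^ 2
  let r₂ := I x - I x'' + ‖g x''‖ ^ 2 - ‖g x‖ ^ 2
  ⟨(2 * mu g x x' x'')⁻¹ * (e * r₁ - δ * r₂), (2 * mu g x x' x'')⁻¹ * (-h * r₁ + c * r₂)⟩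

/-- The approximate sample `f° (2⁻ᴺ k)`, computed from the intensities of `f + g` at `2⁻ᴺ k`,
`2⁻ᴺ k'` and `2⁻ᴺ k''`, where `k' = (1 + 2⁻ᴺ) k` and `k'' = (1 - 2⁻ᴺ) k`. -/
def recoveredSample (f g : E d → ℂ) (N : ℕ) (k : Fin d → ℤ) : ℂ :=
  recover g (intensity f g) ((1 / 2 : ℝ) ^ N • latticePt k)
    ((1 / 2 : ℝ) ^ N • (1 + (1 / 2 : ℝ) ^ N) • latticePt k)
    ((1 / 2 : ℝ) ^ N • (1 - (1 / 2 : ℝ) ^ N) • latticePt k)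

/-- The reconstruction `∑_{k ∈ Λ_{Ω,N}} f° (2⁻ᴺ k) φ (2ᴺ x - k)`. -/
def reconstruction (φ : E d → ℝ) (Ω : Set (E d)) (M : Fin d → ℝ) (f g : E d → ℂ) (N : ℕ)
    (x : E d) : ℂ :=
  ∑ k ∈ Lam Ω M N, recoveredSample f g N k * (φ ((2 : ℝ) ^ N • x - latticePt k) : ℂ)

end PhaseRetrieval

end

open PhaseRetrieval

/-! A difference of two intensities is a perturbed linear equation for `f x`: `I x - I x' + |g x'|²
- |g x|²` equals `2 Re (f x * conj (g x - g x'))` plus a remainder controlled by `|f x - f x'|`. Two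
such equations form a real 2×2 system with determinant proportional to `mu`, and admissibility
bounds its inverse, so a recovered sample is off by at most `γ` times the increment of `f` times the
size of `f` and `g` (`norm_recover_sub_le`). Fourier inversion and Cauchy–Schwarz show that `f` is
bounded and Hölder of order `ζ = min 1 (ς - s)` (`MemSobolev.norm_le`, `MemSobolev.norm_sub_le`),
and the three points of a triple lie at distance `O(2⁻ᴺ)`.

The sum rules force `φ̂` to vanish at the nonzero points of `2πℤᵈ`, so the integer translates of `φ`
sum to one (`finsum_translate_refinable`, Poisson summation). As `φ ≥ 0`, the reconstruction at a
point of `Ω` is a convex combination of recovered samples at distance `O(2⁻ᴺ)`; replacing `f x` by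
exact samples costs `O(2 ^ (-N * ζ))`.

This last error carries no factor `γ`, yet it fits into the second term of the bound. Admissibility
forces `1 ≤ γ * |g x - g x'|` (`one_le_mul_of_admissible`). The modulus of a spherical wave depends
only on its amplitude and the distance to the origin, the sampling points stay away from the origin,
and the amplitude can be read off at an integer point of `Ω`. Hence `1 ≤ const * γ * G`, with a
constant depending on `Ω` only through its geometry. -/

namespace PhaseRetrieval

variable {d : ℕ}

/-! ### Fourier inversion and Sobolev embeddings -/

/-- Fourier inversion: a continuous square-integrable function with integrable Fourier transform
is the inverse Fourier integral of its Fourier transform. -/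
theorem eq_fourierInv_of_integrable {f : E d → ℂ} (hc : Continuous f) (hf : MemLp f 2 volume)
    (hF : Integrable (𝓕 (hf.toLp f) : Lp ℂ 2 (volume : Measure (E d))) volume) (x : E d) :
    f x = 𝓕⁻ (⇑(𝓕 (hf.toLp f) : Lp ℂ 2 (volume : Measure (E d)))) x := by
  set F : Lp ℂ 2 (volume : Measure (E d)) := 𝓕 (hf.toLp f) with hFdef
  have hcont : Continuous (𝓕⁻ (⇑F) : E d → ℂ) := by
    have h := VectorFourier.fourierIntegral_continuous (L := innerₗ (E d))
      Real.continuous_fourierChar continuous_inner hF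
    have : (𝓕⁻ (⇑F) : E d → ℂ) = fun v => 𝓕 (⇑F) (-v) := by
      ext v; exact Real.fourierInv_eq_fourier_neg _ _
    rw [this]
    exact h.comp continuous_neg
  -- Both sides are tested against smooth compactly supported functions. The `L²` inverse transform
  -- agrees with the distributional one, which puts the transform on the test function; Fubini then
  -- moves it back onto the integrable `F`.
  have hae : ∀ᵐ x ∂(volume : Measure (E d)), f x = 𝓕⁻ (⇑F) x := by
    refine ae_eq_of_integral_contDiff_smul_eq hc.locallyIntegrable hcont.locallyIntegrable ?_
    intro g hg hgs
    have hgs' : HasCompactSupport (fun x => (g x : ℂ)) := hgs.comp_left (g := Complex.ofReal) rfl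
    let ψ : SchwartzMap (E d) ℂ := hgs'.toSchwartzMap (Complex.ofRealCLM.contDiff.comp hg)
    have hψ : ∀ x, ψ x = (g x : ℂ) := fun x => rfl
    have hinv : 𝓕⁻ F = hf.toLp f := by rw [hFdef]; exact fourierInv_fourier_eq _
    have h1 := congrArg (fun T => T ψ) (Lp.fourierInv_toTemperedDistribution_eq F)
    simp only [TemperedDistribution.fourierInv_apply, Lp.toTemperedDistribution_apply] at h1
    rw [hinv] at h1
    have h2 : ∫ x, ψ x • (hf.toLp f) x = ∫ x, g x • f x := by
      refine integral_congr_ae ?_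
      filter_upwards [hf.coeFn_toLp] with x hx
      rw [hx, hψ]; simp
    rw [← h2, ← h1]
    have h3 := VectorFourier.integral_fourierIntegral_smul_eq_flip (L := -innerₗ (E d))
      Real.continuous_fourierChar (by
        simp only [LinearMap.neg_apply, innerₗ_apply_apply]
        exact continuous_inner.neg) (ψ.integrable (μ := volume)) hF
    have h4 : ∀ w, VectorFourier.fourierIntegral Real.fourierChar volume (-innerₗ (E d)) ψ w
        = (𝓕⁻ ψ : SchwartzMap (E d) ℂ) w := by
      intro w
      rw [SchwartzMap.fourierInv_coe, Real.fourierInv_eq]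
      simp [VectorFourier.fourierIntegral]
    have h5 : ∀ w, VectorFourier.fourierIntegral Real.fourierChar volume (-innerₗ (E d)).flip F w
        = 𝓕⁻ (⇑F) w := by
      intro w
      rw [Real.fourierInv_eq]
      simp [VectorFourier.fourierIntegral, real_inner_comm]
    simp only [h4, h5, hψ] at h3
    simpa using h3
  exact congrFun ((hc.ae_eq_iff_eq volume hcont).1 hae) x

/-- The Sobolev scale is decreasing in the smoothness index. -/
theorem MemSobolev.mono {f : E d → ℂ} {r t : ℝ} (h : MemSobolev r f) (htr : t ≤ r) :
    MemSobolev t f := by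
  refine ⟨h.1, h.2.mono' ?_ ?_⟩
  · have h1 : AEStronglyMeasurable (fun ξ : E d => ‖fourierL2 f ξ‖ ^ 2 * (1 + ‖ξ‖ ^ 2) ^ r
        * (1 + ‖ξ‖ ^ 2) ^ (t - r)) volume :=
      h.2.1.mul (Continuous.aestronglyMeasurable (by
        refine Continuous.rpow_const (by fun_prop) fun x => Or.inl (by positivity)))
    refine h1.congr (Filter.Eventually.of_forall fun ξ => ?_)
    have : (0 : ℝ) < 1 + ‖ξ‖ ^ 2 := by positivity
    simp only [mul_assoc, ← Real.rpow_add this]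
    congr 3; ring
  · refine Filter.Eventually.of_forall fun ξ => ?_
    rw [Real.norm_of_nonneg (by positivity)]
    gcongr
    nlinarith [sq_nonneg ‖ξ‖]

theorem memSobolev_of_lt_sobolevExponent {f : E d → ℂ} {r : ℝ}
    (h : (r : EReal) < sobolevExponent f) : MemSobolev r f := by
  obtain ⟨t, ht⟩ := lt_iSup_iff.1 h
  obtain ⟨ht1, ht2⟩ := lt_iSup_iff.1 ht
  exact MemSobolev.mono ht1 (EReal.coe_lt_coe_iff.1 ht2).le

theorem sobolevNorm_nonneg (r : ℝ) (f : E d → ℂ) : 0 ≤ sobolevNorm r f := by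
  unfold sobolevNorm; positivity

/-- The Sobolev condition and norm in terms of Mathlib's Fourier transform. -/
theorem MemSobolev.integrable_weight {f : E d → ℂ} {r : ℝ} (h : MemSobolev r f) :
    Integrable (fun w : E d => ‖(𝓕 (h.1.toLp f) : Lp ℂ 2 (volume : Measure (E d))) w‖ ^ 2 *
      (1 + ‖(2 * Real.pi) • w‖ ^ 2) ^ r) volume := by
  have h2 := h.2.comp_smul (R := (2 * Real.pi)) (by positivity)
  refine h2.congr (Filter.Eventually.of_forall fun w => ?_)
  simp only [fourierL2, dif_pos h.1]
  rw [inv_smul_smul₀ (by positivity)]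

/-- The Jacobian of `ξ = 2πw` cancels the prefactor `(2π) ^ (-d/2)` of the norm, so that no constant
remains. -/
theorem MemSobolev.sobolevNorm_eq {f : E d → ℂ} {r : ℝ} (h : MemSobolev r f) :
    sobolevNorm r f =
      √(∫ w : E d, ‖(𝓕 (h.1.toLp f) : Lp ℂ 2 (volume : Measure (E d))) w‖ ^ 2 *
      (1 + ‖(2 * Real.pi) • w‖ ^ 2) ^ r) := by
  have h2 := Measure.integral_comp_smul (volume : Measure (E d))
    (fun ξ => ‖fourierL2 f ξ‖ ^ 2 * (1 + ‖ξ‖ ^ 2) ^ r) (2 * Real.pi)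
  have h3 : (fun w : E d => ‖fourierL2 f ((2 * Real.pi) • w)‖ ^ 2 *
      (1 + ‖(2 * Real.pi) • w‖ ^ 2) ^ r) = fun w : E d =>
      ‖(𝓕 (h.1.toLp f) : Lp ℂ 2 (volume : Measure (E d))) w‖ ^ 2 *
      (1 + ‖(2 * Real.pi) • w‖ ^ 2) ^ r := by
    ext w
    simp only [fourierL2, dif_pos h.1]
    rw [inv_smul_smul₀ (by positivity)]
  rw [h3] at h2
  rw [h2, sobolevNorm, finrank_euclideanSpace_fin, abs_of_pos (by positivity), smul_eq_mul,
    Real.sqrt_mul (by positivity), Real.sqrt_inv]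
  congr 2
  rw [Real.sqrt_eq_rpow, ← Real.rpow_natCast, ← Real.rpow_mul (by positivity)]
  congr 1; ring

/-- The constant of the Sobolev embedding. -/
noncomputable def sobolevConst (d : ℕ) (q : ℝ) : ℝ :=
  √(∫ w : E d, (1 + ‖(2 * Real.pi) • w‖ ^ 2) ^ (-q))

theorem integrable_rpow_neg_weight {q : ℝ} (hq : (d : ℝ) / 2 < q) :
    Integrable (fun w : E d => (1 + ‖(2 * Real.pi) • w‖ ^ 2) ^ (-q)) volume := by
  have h := integrable_rpow_neg_one_add_norm_sq (E := E d) (μ := volume) (r := 2 * q)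
    (by rw [finrank_euclideanSpace_fin]; linarith)
  have h2 := h.comp_smul (R := (2 * Real.pi)) (by positivity)
  refine h2.congr (Filter.Eventually.of_forall fun w => ?_)
  simp only; congr 1; ring

/-- Cauchy–Schwarz on the Fourier side. -/
theorem MemSobolev.integral_weight_le {f : E d → ℂ} {r t : ℝ} (h : MemSobolev r f)
    (hrt : (d : ℝ) / 2 < r - t) :
    Integrable (fun w : E d => ‖(𝓕 (h.1.toLp f) : Lp ℂ 2 (volume : Measure (E d))) w‖ *
      (1 + ‖(2 * Real.pi) • w‖ ^ 2) ^ (t / 2)) volume ∧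
    ∫ w : E d, ‖(𝓕 (h.1.toLp f) : Lp ℂ 2 (volume : Measure (E d))) w‖ *
      (1 + ‖(2 * Real.pi) • w‖ ^ 2) ^ (t / 2) ≤ sobolevNorm r f * sobolevConst d (r - t) := by
  set F : Lp ℂ 2 (volume : Measure (E d)) := 𝓕 (h.1.toLp f) with hFdef
  have hw := h.integrable_weight
  rw [← hFdef] at hw
  have hcont : ∀ p : ℝ, Continuous fun w : E d => (1 + ‖(2 * Real.pi) • w‖ ^ 2) ^ p := fun p =>
    Continuous.rpow_const (by fun_prop) fun x => Or.inl (by positivity)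
  have hpos : ∀ w : E d, 0 < 1 + ‖(2 * Real.pi) • w‖ ^ 2 := fun w => by positivity
  -- The weight is split as `r/2 + (t - r)/2`: the first factor has `L²` norm `sobolevNorm r f`, the
  -- second is square integrable because `r - t > d/2`.
  have hu : MemLp (fun w : E d => ‖F w‖ * (1 + ‖(2 * Real.pi) • w‖ ^ 2) ^ (r / 2))
      2 volume := by
    refine (memLp_two_iff_integrable_sq
      ((Lp.aestronglyMeasurable F).norm.mul (hcont _).aestronglyMeasurable)).2 ?_
    refine hw.congr (Filter.Eventually.of_forall fun w => ?_)
    simp only [Pi.mul_apply, mul_pow]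
    rw [← Real.rpow_mul_natCast (hpos w).le]; congr 2; push_cast; ring
  have hv : MemLp (fun w : E d => (1 + ‖(2 * Real.pi) • w‖ ^ 2) ^ ((t - r) / 2))
      2 volume := by
    rw [memLp_two_iff_integrable_sq (hcont _).aestronglyMeasurable]
    refine (integrable_rpow_neg_weight hrt).congr (Filter.Eventually.of_forall fun w => ?_)
    simp only
    rw [← Real.rpow_mul_natCast (hpos w).le]; congr 1; push_cast; ring
  have huv : ∀ w : E d, ‖F w‖ * (1 + ‖(2 * Real.pi) • w‖ ^ 2) ^ (t / 2) =
      ‖F w‖ * (1 + ‖(2 * Real.pi) • w‖ ^ 2) ^ (r / 2) *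
        (1 + ‖(2 * Real.pi) • w‖ ^ 2) ^ ((t - r) / 2) := fun w => by
    rw [mul_assoc, ← Real.rpow_add (hpos w)]; congr 2; ring
  refine ⟨(hu.integrable_mul hv).congr (Filter.Eventually.of_forall fun w => (huv w).symm), ?_⟩
  simp_rw [huv]
  have hH := integral_mul_le_Lp_mul_Lq_of_nonneg (μ := (volume : Measure (E d)))
    Real.HolderConjugate.two_two
    (f := fun w : E d => ‖F w‖ * (1 + ‖(2 * Real.pi) • w‖ ^ 2) ^ (r / 2))
    (g := fun w : E d => (1 + ‖(2 * Real.pi) • w‖ ^ 2) ^ ((t - r) / 2))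
    (Filter.Eventually.of_forall fun w => by positivity)
    (Filter.Eventually.of_forall fun w => by positivity)
    (by simpa using hu) (by simpa using hv)
  refine hH.trans (le_of_eq ?_)
  rw [h.sobolevNorm_eq, sobolevConst, Real.sqrt_eq_rpow, Real.sqrt_eq_rpow]
  congr 3
  · ext w
    rw [Real.mul_rpow (by positivity) (by positivity), ← Real.rpow_mul (hpos w).le,
      Real.rpow_two]
    congr 2; ring
  · ext w
    rw [← Real.rpow_mul (hpos w).le]
    congr 1; ring

/-- The Sobolev embedding into bounded functions. -/
theorem MemSobolev.norm_le {f : E d → ℂ} {r : ℝ} (hc : Continuous f) (h : MemSobolev r f)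
    (hr : (d : ℝ) / 2 < r) (x : E d) : ‖f x‖ ≤ sobolevNorm r f * sobolevConst d r := by
  obtain ⟨hi, hle⟩ := h.integral_weight_le (t := 0) (by simpa using hr)
  simp only [zero_div, Real.rpow_zero, mul_one, sub_zero] at hi hle
  rw [eq_fourierInv_of_integrable hc h.1 ((integrable_norm_iff (Lp.aestronglyMeasurable _)).1 hi) x,
    Real.fourierInv_eq]
  exact (norm_integral_le_integral_norm _).trans (by simpa using hle)

/-- Interpolation between the Lipschitz bound `t` and the trivial bound `2`, where `t = 2π|a - b|`:
use `t ≤ t ^ ζ` for `t ≤ 1` and `1 ≤ t ^ ζ` for `t ≥ 1`. -/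
theorem norm_fourierChar_sub_le (a b : ℝ) {ζ : ℝ} (h0 : 0 ≤ ζ) (h1 : ζ ≤ 1) :
    ‖(Real.fourierChar a : ℂ) - Real.fourierChar b‖ ≤ 2 * (2 * Real.pi * |a - b|) ^ ζ := by
  have e1 : (Real.fourierChar a : ℂ) - Real.fourierChar b =
      Real.fourierChar b * (Complex.exp (Complex.I * (2 * Real.pi * (a - b) : ℝ)) - 1) := by
    rw [Real.fourierChar_apply, Real.fourierChar_apply, mul_sub, ← Complex.exp_add, mul_one]
    congr 2; push_cast; ring
  rw [e1, norm_mul, Circle.norm_coe, one_mul]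
  set t := 2 * Real.pi * |a - b| with ht
  have ht0 : 0 ≤ t := by positivity
  have e2 : ‖(2 * Real.pi * (a - b) : ℝ)‖ = t := by
    rw [Real.norm_eq_abs, abs_mul, abs_of_pos (by positivity)]
  rcases le_total t 1 with h | h
  · calc _ ≤ ‖(2 * Real.pi * (a - b) : ℝ)‖ := Real.norm_exp_I_mul_ofReal_sub_one_le
      _ = t ^ (1 : ℝ) := by rw [e2, Real.rpow_one]
      _ ≤ t ^ ζ := Real.rpow_le_rpow_of_exponent_ge_of_imp ht0 h h1 (by
          intro h _; rcases h0.eq_or_lt with h | h <;> simp_all)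
      _ ≤ _ := by have := Real.rpow_nonneg ht0 ζ; linarith
  · calc _ ≤ ‖Complex.exp (Complex.I * (2 * Real.pi * (a - b) : ℝ))‖ + ‖(1 : ℂ)‖ := norm_sub_le _ _
      _ = 2 := by rw [mul_comm Complex.I, Complex.norm_exp_ofReal_mul_I]; norm_num
      _ ≤ _ := by have := Real.one_le_rpow h h0; linarith

/-- The Sobolev embedding into Hölder continuous functions. -/
theorem MemSobolev.norm_sub_le {f : E d → ℂ} {r ζ : ℝ} (hc : Continuous f) (h : MemSobolev r f)
    (h0 : 0 ≤ ζ) (h1 : ζ ≤ 1) (hr : (d : ℝ) / 2 < r - ζ) (x y : E d) :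
    ‖f x - f y‖ ≤ 2 * sobolevNorm r f * sobolevConst d (r - ζ) * ‖x - y‖ ^ ζ := by
  obtain ⟨hi, -⟩ := h.integral_weight_le (t := 0) (by linarith)
  simp only [zero_div, Real.rpow_zero, mul_one] at hi
  -- Here the weight exponent is `ζ / 2`; it absorbs the factor `‖2πv‖ ^ ζ` coming from the Hölder
  -- bound for the characters.
  obtain ⟨hi', hle'⟩ := h.integral_weight_le hr
  have hF := (integrable_norm_iff (Lp.aestronglyMeasurable _)).1 hi
  rw [eq_fourierInv_of_integrable hc h.1 hF x, eq_fourierInv_of_integrable hc h.1 hF y,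
    Real.fourierInv_eq, Real.fourierInv_eq]
  set F : Lp ℂ 2 (volume : Measure (E d)) := 𝓕 (h.1.toLp f) with hFdef
  have hint : ∀ z : E d, Integrable (fun v : E d => Real.fourierChar (inner ℝ v z) • F v) volume :=
    fun z => by simpa using (Real.fourierIntegral_convergent_iff (-z)).2 hF
  rw [← integral_sub (hint x) (hint y)]
  calc _ ≤ ∫ v, ‖F v‖ * (1 + ‖(2 * Real.pi) • v‖ ^ 2) ^ (ζ / 2) * (2 * ‖x - y‖ ^ ζ) := by
        refine norm_integral_le_of_norm_le (hi'.mul_const _)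
          (Filter.Eventually.of_forall fun v => ?_)
        rw [Circle.smul_def, Circle.smul_def, ← sub_smul, norm_smul]
        have e1 := norm_fourierChar_sub_le (inner ℝ v x) (inner ℝ v y) h0 h1
        have e2 : 2 * Real.pi * |inner ℝ v x - inner ℝ v y| ≤ ‖(2 * Real.pi) • v‖ * ‖x - y‖ := by
          rw [← inner_sub_right, norm_smul, Real.norm_of_nonneg (by positivity),
            mul_assoc (2 * Real.pi)]
          refine mul_le_mul_of_nonneg_left ?_ (by positivity)
          exact abs_real_inner_le_norm v (x - y)
        have e3 : ‖(2 * Real.pi) • v‖ ^ ζ ≤ (1 + ‖(2 * Real.pi) • v‖ ^ 2) ^ (ζ / 2) := by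
          have : ‖(2 * Real.pi) • v‖ ^ ζ = (‖(2 * Real.pi) • v‖ ^ 2) ^ (ζ / 2) := by
            rw [← Real.rpow_two, ← Real.rpow_mul (norm_nonneg _)]; congr 1; ring
          rw [this]
          gcongr; linarith
        calc _ ≤ 2 * (‖(2 * Real.pi) • v‖ * ‖x - y‖) ^ ζ * ‖F v‖ := by
              gcongr; exact e1.trans (by gcongr)
          _ ≤ _ := by
              rw [Real.mul_rpow (norm_nonneg _) (norm_nonneg _)]
              have : 0 ≤ ‖x - y‖ ^ ζ := by positivity
              calc _ = ‖F v‖ * ‖(2 * Real.pi) • v‖ ^ ζ * (2 * ‖x - y‖ ^ ζ) := by ring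
                _ ≤ _ := by gcongr
    _ ≤ sobolevNorm r f * sobolevConst d (r - ζ) * (2 * ‖x - y‖ ^ ζ) := by
        rw [integral_mul_const]; gcongr
    _ = _ := by ring

/-! ### Poisson summation and the partition of unity -/

/-- If `ψ` vanishes outside the ball of radius `R`, only lattice points in a fixed box contribute
to the periodization of `ψ` on a ball of radius `ρ`. -/
theorem mem_Icc_of_translate_ne_zero {ψ : (Fin d → ℝ) → ℂ} {R ρ : ℝ}
    (hR : ∀ x, ψ x ≠ 0 → ‖x‖ ≤ R) {x : Fin d → ℝ} (hx : ‖x‖ ≤ ρ) {k : Fin d → ℤ}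
    (hk : ψ (x + fun i => (k i : ℝ)) ≠ 0) :
    k ∈ Finset.Icc (fun _ : Fin d => -⌈R + ρ⌉) (fun _ => ⌈R + ρ⌉) := by
  have h1 : ∀ i, |(k i : ℝ)| ≤ R + ρ := by
    intro i
    have h2 := (norm_le_pi_norm _ i).trans (hR _ hk)
    have h3 := (norm_le_pi_norm x i).trans hx
    simp only [Pi.add_apply, Real.norm_eq_abs] at h2 h3
    rw [abs_le] at *
    constructor <;> linarith
  rw [Finset.mem_Icc]
  constructor <;> intro i <;> have := abs_le.1 (h1 i) <;> have h4 := Int.le_ceil (R + ρ)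
  · have : -((⌈R + ρ⌉ : ℤ) : ℝ) ≤ k i := by linarith
    exact_mod_cast this
  · have : (k i : ℝ) ≤ (⌈R + ρ⌉ : ℤ) := by linarith
    exact_mod_cast this

/-- This is what makes the periodization of a continuous `ψ` continuous. -/
theorem locallyFinite_support_translate {ψ : (Fin d → ℝ) → ℂ} {R : ℝ}
    (hR : ∀ x, ψ x ≠ 0 → ‖x‖ ≤ R) :
    LocallyFinite fun k : Fin d → ℤ => Function.support fun x => ψ (x + fun i => (k i : ℝ)) := by
  intro x
  refine ⟨Metric.ball x 1, Metric.ball_mem_nhds x one_pos, ?_⟩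
  refine (Finset.finite_toSet
    (Finset.Icc (fun _ : Fin d => -⌈R + (‖x‖ + 1)⌉) (fun _ => ⌈R + (‖x‖ + 1)⌉))).subset ?_
  rintro k ⟨y, hy1, hy2⟩
  refine mem_Icc_of_translate_ne_zero hR ?_ hy1
  have h1 : ‖y - x‖ < 1 := by rwa [← dist_eq_norm]
  have h2 := norm_add_le x (y - x)
  rw [add_sub_cancel] at h2
  linarith

/-- The integral over `ℝᵈ` is the sum of the integrals over the unit cubes. -/
theorem hasSum_integral_unitCube {h : (Fin d → ℝ) → ℂ} (hh : Integrable h volume) :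
    HasSum (fun k : Fin d → ℤ => ∫ x in {x : Fin d → ℝ | ∀ i, x i ∈ Set.Ioc (0 : ℝ) (0 + 1)},
      h (x + fun i => (k i : ℝ))) (∫ x, h x) := by
  let Q : (Fin d → ℤ) → Set (Fin d → ℝ) := fun k =>
    {x | ∀ i, x i ∈ Set.Ioc (k i : ℝ) (k i + 1)}
  have hmeas : ∀ k, MeasurableSet (Q k) := fun k =>
    MeasurableSet.univ_pi' fun i => measurableSet_Ioc
  -- The cubes are open on the left and closed on the right, so the cube of `x` is found by ceilings
  -- minus one.
  have hceil : ∀ k x, x ∈ Q k ↔ ∀ i, ⌈x i⌉ - 1 = k i := by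
    intro k x
    refine forall_congr' fun i => ?_
    rw [Set.mem_Ioc, sub_eq_iff_eq_add, Int.ceil_eq_iff]
    push_cast
    constructor <;> rintro ⟨h1, h2⟩ <;> constructor <;> linarith
  have hdisj : Pairwise (Function.onFun Disjoint Q) := by
    intro k l hkl
    refine Set.disjoint_left.2 fun x hx hx' => hkl ?_
    ext i
    rw [← (hceil k x).1 hx i, (hceil l x).1 hx' i]
  have hunion : ⋃ k, Q k = Set.univ := by
    refine Set.eq_univ_of_forall fun x => Set.mem_iUnion.2 ⟨fun i => ⌈x i⌉ - 1, ?_⟩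
    exact (hceil _ x).2 fun i => rfl
  have hsum := hasSum_integral_iUnion hmeas hdisj (μ := volume) (f := h) hh.integrableOn
  rw [hunion, setIntegral_univ] at hsum
  convert! hsum using 2 with k
  have hp := (measurePreserving_add_right (volume : Measure (Fin d → ℝ))
    (fun i => (k i : ℝ))).setIntegral_preimage_emb
    (measurableEmbedding_addRight _) h (Q k)
  rw [← hp]
  congr 2
  ext x
  simp only [Q, Set.mem_ofPred_eq, Set.mem_preimage, Pi.add_apply, Set.mem_Ioc]
  refine forall_congr' fun i => ?_
  constructor <;> rintro ⟨h1, h2⟩ <;> constructor <;> linarith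

/-- A compactly supported continuous function whose Fourier transform vanishes at all nonzero
lattice points and is `1` at the origin generates a partition of unity. -/
theorem finsum_translate_eq_one {ψ : (Fin d → ℝ) → ℂ} (hc : Continuous ψ)
    (hs : HasCompactSupport ψ)
    (h : ∀ n : Fin d → ℤ, ∫ x : Fin d → ℝ,
      UnitAddTorus.mFourier (-n) (fun i => (x i : UnitAddCircle)) * ψ x = if n = 0 then 1 else 0)
    (x : Fin d → ℝ) : ∑ᶠ k : Fin d → ℤ, ψ (x + fun i => (k i : ℝ)) = 1 := by
  obtain ⟨R, hR⟩ := hs.isCompact.isBounded.exists_norm_le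
  replace hR : ∀ x, ψ x ≠ 0 → ‖x‖ ≤ R := fun x hx => hR x (subset_tsupport _ hx)
  let S : (Fin d → ℝ) → ℂ := fun x => ∑ᶠ k : Fin d → ℤ, ψ (x + fun i => (k i : ℝ))
  have hS : Continuous S := continuous_finsum
    (fun k => hc.comp (by fun_prop)) (locallyFinite_support_translate hR)
  have hSper : ∀ x (m : Fin d → ℤ), S (x + fun i => (m i : ℝ)) = S x := by
    intro x m
    have := finsum_comp_equiv (f := fun k : Fin d → ℤ => ψ (x + fun i => (k i : ℝ)))
      (Equiv.addLeft m)
    simp only [S]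
    rw [← this]
    refine finsum_congr fun k => ?_
    congr 1; ext i; simp [add_assoc]
  let π : (Fin d → ℝ) → UnitAddTorus (Fin d) := fun x i => (x i : UnitAddCircle)
  have hπ : IsQuotientMap π :=
    (IsOpenQuotientMap.piMap (f := fun (_ : Fin d) (t : ℝ) => (t : UnitAddCircle))
      fun _ => QuotientAddGroup.isOpenQuotientMap_mk).isQuotientMap
  -- The periodization is constant on the fibres of `π`, so it descends to a continuous function on
  -- the torus.
  have hfac : Function.FactorsThrough (⟨S, hS⟩ : C(Fin d → ℝ, ℂ)) π := by
    intro x y hxy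
    have hm : ∀ i, ∃ m : ℤ, y i = x i + m := by
      intro i
      have h1 : (x i : UnitAddCircle) = (y i : UnitAddCircle) := congrFun hxy i
      rw [QuotientAddGroup.eq] at h1
      obtain ⟨m, hm⟩ := AddSubgroup.mem_zmultiples_iff.1 h1
      exact ⟨m, by simp at hm; linarith⟩
    choose m hm using hm
    have : y = x + fun i => (m i : ℝ) := funext hm
    rw [this]
    exact (hSper x m).symm
  have hπ' : IsQuotientMap (⟨π, hπ.continuous⟩ : C(Fin d → ℝ, UnitAddTorus (Fin d))) := hπ
  let f : C(UnitAddTorus (Fin d), ℂ) := hπ'.lift ⟨S, hS⟩ hfac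
  have hf : ∀ x, f (π x) = S x := fun x =>
    congrArg (fun g : C(Fin d → ℝ, ℂ) => g x) (hπ'.lift_comp ⟨S, hS⟩ hfac)
  -- Unfolding: a Fourier coefficient of the periodization is the integral of `ψ` against the same
  -- character over all of `ℝᵈ`, cut into unit cubes. Only the finitely many cubes indexed by `T`
  -- below contribute.
  have hcoeff : ∀ n, UnitAddTorus.mFourierCoeff f n = if n = 0 then 1 else 0 := by
    intro n
    have hecont : Continuous fun x => UnitAddTorus.mFourier (-n) (π x) :=
      (UnitAddTorus.mFourier (-n)).continuous.comp hπ.continuous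
    have hint : Integrable (fun x => UnitAddTorus.mFourier (-n) (π x) * ψ x) volume :=
      (hecont.mul hc).integrable_of_hasCompactSupport hs.mul_left
    have hper : ∀ x (k : Fin d → ℤ), π (x + fun i => (k i : ℝ)) = π x := by
      intro x k
      ext i
      simp [π]
    rw [UnitAddTorus.mFourierCoeff_eq_integral f n 0, ← h n]
    refine HasSum.unique ?_ (hasSum_integral_unitCube hint)
    set T := Finset.Icc (fun _ : Fin d => -⌈R + 1⌉) (fun _ => ⌈R + 1⌉) with hT
    have hQ : MeasurableSet {x : Fin d → ℝ | ∀ i, x i ∈ Set.Ioc (0 : ℝ) (0 + 1)} :=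
      MeasurableSet.univ_pi' fun i => measurableSet_Ioc
    have hvan : ∀ x ∈ {x : Fin d → ℝ | ∀ i, x i ∈ Set.Ioc (0 : ℝ) (0 + 1)}, ∀ k ∉ T,
        ψ (x + fun i => (k i : ℝ)) = 0 := by
      intro x hx k hk
      by_contra hne
      refine hk (mem_Icc_of_translate_ne_zero hR ?_ hne)
      refine (pi_norm_le_iff_of_nonneg zero_le_one).2 fun i => ?_
      have := hx i
      rw [Real.norm_eq_abs, abs_le]
      constructor <;> linarith [this.1, this.2]
    have e1 : ∫ x in {x : Fin d → ℝ | ∀ i, x i ∈ Set.Ioc ((0 : Fin d → ℝ) i)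
          ((0 : Fin d → ℝ) i + 1)}, UnitAddTorus.mFourier (-n) (π x) • f (π x) =
        ∑ k ∈ T, ∫ x in {x : Fin d → ℝ | ∀ i, x i ∈ Set.Ioc (0 : ℝ) (0 + 1)},
          UnitAddTorus.mFourier (-n) (π (x + fun i => (k i : ℝ))) *
            ψ (x + fun i => (k i : ℝ)) := by
      rw [← integral_finsetSum _ fun k _ => (hint.comp_add_right _).integrableOn]
      refine setIntegral_congr_fun hQ fun x hx => ?_
      simp only [hper, hf, S, smul_eq_mul, ← Finset.mul_sum]
      congr 1
      refine finsum_eq_sum_of_support_subset _ fun k hk => ?_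
      by_contra hkT
      exact hk (hvan x hx k hkT)
    refine (congrArg (HasSum _) e1).mpr (hasSum_sum_of_ne_finset_zero fun k hk => ?_)
    refine (setIntegral_congr_fun hQ fun x hx => ?_).trans (integral_zero _ _)
    simp only [hvan x hx k hk, mul_zero]
  -- Only the zeroth coefficient survives, so the Fourier series converges pointwise, and its sum is
  -- the constant `1`.
  have hsummable : Summable (UnitAddTorus.mFourierCoeff f) :=
    summable_of_ne_finset_zero (s := {0}) fun n hn => by
      rw [hcoeff, if_neg (by simpa using hn)]
  have h1 := UnitAddTorus.hasSum_mFourier_series_apply_of_summable hsummable (π x)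
  rw [hf] at h1
  refine h1.unique ?_
  have h2 : HasSum (fun n => UnitAddTorus.mFourierCoeff f n • UnitAddTorus.mFourier n (π x)) _ :=
    hasSum_single 0 fun n hn => by rw [hcoeff, if_neg hn, zero_smul]
  simpa only [hcoeff, if_true, UnitAddTorus.mFourier_zero, ContinuousMap.one_apply, one_smul]
    using h2

/-- The Fourier transform of a refinable function vanishes at the nonzero points of `2πℤᵈ`. -/
theorem fourierInt_two_pi_lattice {φ A : E d → ℂ} (h : IsRefinable φ A) {n : ℕ}
    (hA : HasSumRules A (n + 1)) (k : Fin d → ℤ) :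
    fourierInt φ ((2 * Real.pi) • latticePt k) = if k = 0 then 1 else 0 := by
  split_ifs with hk
  · have : latticePt k = 0 := by ext l; simp [latticePt, hk]
    rw [this, smul_zero, h.normalized]
  -- Refinement gives `φ̂(2πk) = A(πk) φ̂(πk)`. If `k` has an odd entry, the mask vanishes;
  -- otherwise `k = 2m` and the induction on the size of the entries continues with `m`.
  have hmain : ∀ b : ℕ, ∀ k : Fin d → ℤ, k ≠ 0 → (∀ l, (k l).natAbs < b) →
      fourierInt φ ((2 * Real.pi) • latticePt k) = 0 := by
    intro b
    induction b with
    | zero =>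
      intro k hk hb
      exact absurd (funext fun l => absurd (hb l) (Nat.not_lt_zero _)) hk
    | succ b ih =>
      intro k hk hb
      rw [mul_smul, h.refine]
      by_cases hodd : ∃ l, Odd (k l)
      · have h1 := (hA k hodd).eq_zero_imp.self_of_nhds (by simp)
        rw [zero_add] at h1
        rw [h1, zero_mul]
      · push Not at hodd
        have h2 : ∀ l, ∃ m, k l = 2 * m := fun l => by
          obtain ⟨m, hm⟩ := Int.not_odd_iff_even.1 (hodd l)
          exact ⟨m, by omega⟩
        choose m hm using h2
        have h3 : Real.pi • latticePt k = (2 * Real.pi) • latticePt m := by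
          ext l
          simp [latticePt, hm]; ring
        have hm0 : m ≠ 0 := by
          rintro rfl
          exact hk (funext fun l => by simp [hm])
        -- Halving lowers the strict bound `b + 1` to `b` unless `b = 0`, in which case `m = 0`.
        by_cases hb0 : ∀ l, (m l).natAbs < b
        · rw [h3, ih m hm0 hb0, mul_zero]
        · push Not at hb0
          obtain ⟨l, hl⟩ := hb0
          have := hb l
          have := hm l
          have hmb : ∀ l, (m l).natAbs < b ∨ m l = 0 := fun l => by
            have := hb l
            have := hm l
            omega
          have hml : m l = 0 := by have := hmb l; omega
          have hb00 : b = 0 := by rw [hml] at hl; simpa using hl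
          exact absurd (funext fun l => by have := hmb l; simp; omega) hm0
  exact hmain (∑ l, (k l).natAbs + 1) k hk fun l =>
    Nat.lt_succ_of_le (Finset.single_le_sum (f := fun l => (k l).natAbs)
      (fun _ _ => Nat.zero_le _) (Finset.mem_univ l))

/-- The integer translates of a compactly supported continuous refinable function whose mask
satisfies sum rules form a partition of unity. -/
theorem finsum_translate_refinable {φ A : E d → ℂ} (hc : Continuous φ) (hs : HasCompactSupport φ)
    (h : IsRefinable φ A) {n : ℕ} (hA : HasSumRules A (n + 1)) (x : E d) :
    ∑ᶠ k : Fin d → ℤ, φ (x - latticePt k) = 1 := by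
  have h1 := finsum_translate_eq_one (ψ := fun y => φ (WithLp.toLp 2 y))
    (hc.comp (PiLp.continuous_toLp 2 _))
    (hs.comp_homeomorph (PiLp.homeomorph 2 (fun _ : Fin d => ℝ)).symm) (fun k => by
      rw [← fourierInt_two_pi_lattice h hA k, fourierInt,
        ← (PiLp.volume_preserving_toLp (Fin d)).integral_comp
          (MeasurableEquiv.toLp 2 (Fin d → ℝ)).measurableEmbedding]
      refine integral_congr_ae (Filter.Eventually.of_forall fun y => ?_)
      simp only [UnitAddTorus.mFourier, ContinuousMap.coe_mk, fourier_coe_apply]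
      rw [mul_comm, ← Complex.exp_sum]
      congr 2
      simp only [latticePt, PiLp.inner_apply, inner_smul_right, Pi.neg_apply]
      push_cast
      rw [Finset.mul_sum, Finset.mul_sum]
      refine Finset.sum_congr rfl fun i _ => ?_
      simp
      ring) x.ofLp
  refine Eq.trans ?_ h1
  rw [← finsum_comp_equiv (f := fun k => φ (x - latticePt k)) (Equiv.neg (Fin d → ℤ))]
  refine finsum_congr fun k => ?_
  congr 1
  ext l
  simp [latticePt, sub_eq_add_neg]

/-! ### Stability of the phase recovery -/

/-- The error of the recovered value in terms of the two perturbations of the linear system. -/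
theorem recover_sub_eq (f g : E d → ℂ) {x x' x'' : E d} (hμ : mu g x x' x'' ≠ 0) :
    recover g (intensity f g) x x' x'' - f x = (((2 * mu g x x' x'')⁻¹ : ℝ) : ℂ) *
      (((‖f x‖ ^ 2 - ‖f x'‖ ^ 2 + 2 * ((f x - f x') * starRingEnd ℂ (g x')).re : ℝ) : ℂ) *
          (-Complex.I * (g x - g x'')) +
        ((‖f x‖ ^ 2 - ‖f x''‖ ^ 2 + 2 * ((f x - f x'') * starRingEnd ℂ (g x'')).re : ℝ) : ℂ) *
          (Complex.I * (g x - g x'))) := by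
  have hμ' : mu g x x' x'' = (g x - g x').re * (g x - g x'').im
      - (g x - g x').im * (g x - g x'').re := by
    simp [mu, Complex.mul_im]; ring
  -- The true value is written with the same factor `(2μ)⁻¹`, so that both components become
  -- polynomial identities.
  have hF : ∀ t : ℝ, t = (2 * mu g x x' x'')⁻¹ * (2 * ((g x - g x').re * (g x - g x'').im
      - (g x - g x').im * (g x - g x'').re) * t) := fun t => by
    rw [← hμ']; field_simp
  apply Complex.ext
  · rw [Complex.sub_re, hF (f x).re]
    simp only [recover, intensity, ← Complex.normSq_eq_norm_sq, Complex.normSq_apply,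
      Complex.add_re, Complex.add_im, Complex.sub_re, Complex.sub_im,
      Complex.mul_re, Complex.mul_im, Complex.conj_re, Complex.conj_im, Complex.I_re,
      Complex.I_im, Complex.neg_re, Complex.neg_im, Complex.ofReal_re, Complex.ofReal_im]
    ring
  · rw [Complex.sub_im, hF (f x).im]
    simp only [recover, intensity, ← Complex.normSq_eq_norm_sq, Complex.normSq_apply,
      Complex.add_re, Complex.add_im, Complex.sub_re, Complex.sub_im,
      Complex.mul_re, Complex.mul_im, Complex.conj_re, Complex.conj_im, Complex.I_re,
      Complex.I_im, Complex.neg_re, Complex.neg_im, Complex.ofReal_re, Complex.ofReal_im]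
    ring

/-- Difference of squares for the moduli, Cauchy–Schwarz for the cross term: both contain the
increment `u - v`. -/
theorem abs_perturbation_le (u v w : ℂ) :
    |‖u‖ ^ 2 - ‖v‖ ^ 2 + 2 * ((u - v) * starRingEnd ℂ w).re| ≤
      ‖u - v‖ * (‖u‖ + ‖v‖ + 2 * ‖w‖) := by
  have h1 : |‖u‖ ^ 2 - ‖v‖ ^ 2| ≤ ‖u - v‖ * (‖u‖ + ‖v‖) := by
    rw [sq_sub_sq, abs_mul, abs_of_nonneg (by positivity), mul_comm]
    exact mul_le_mul_of_nonneg_right (abs_norm_sub_norm_le u v) (by positivity)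
  have h2 : |2 * ((u - v) * starRingEnd ℂ w).re| ≤ ‖u - v‖ * (2 * ‖w‖) := by
    rw [abs_mul, abs_two]
    have := Complex.abs_re_le_norm ((u - v) * starRingEnd ℂ w)
    rw [norm_mul, RCLike.norm_conj] at this
    linarith
  calc _ ≤ |‖u‖ ^ 2 - ‖v‖ ^ 2| + |2 * ((u - v) * starRingEnd ℂ w).re| := abs_add_le _ _
    _ ≤ _ := by linarith

/-- Stability of the recovery of one sample. -/
theorem norm_recover_sub_le (f g : E d → ℂ) {x x' x'' : E d} {γ ω B : ℝ}
    (hμ : mu g x x' x'' ≠ 0)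
    (hγ : max ‖g x - g x'‖ ‖starRingEnd ℂ (g x) - starRingEnd ℂ (g x'')‖ / |mu g x x' x''| ≤ γ)
    (h1 : ‖f x - f x'‖ ≤ ω) (h2 : ‖f x - f x''‖ ≤ ω)
    (hB1 : ‖f x‖ + ‖f x'‖ + 2 * ‖g x'‖ ≤ B) (hB2 : ‖f x‖ + ‖f x''‖ + 2 * ‖g x''‖ ≤ B) :
    ‖recover g (intensity f g) x x' x'' - f x‖ ≤ γ * (ω * B) := by
  have hω : 0 ≤ ω := (norm_nonneg _).trans h1
  have hB : 0 ≤ B := le_trans (by positivity) hB1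
  have hpos : 0 < |mu g x x' x''| := abs_pos.2 hμ
  rw [div_le_iff₀ hpos, ← map_sub, RCLike.norm_conj, max_le_iff] at hγ
  have e1 := (abs_perturbation_le (f x) (f x') (g x')).trans
    (mul_le_mul h1 hB1 (by positivity) hω)
  have e2 := (abs_perturbation_le (f x) (f x'') (g x'')).trans
    (mul_le_mul h2 hB2 (by positivity) hω)
  rw [recover_sub_eq f g hμ, norm_mul, Complex.norm_real, norm_inv, norm_mul, Real.norm_eq_abs,
    Real.norm_eq_abs, abs_two, inv_mul_le_iff₀ (by positivity)]
  refine (norm_add_le _ _).trans ?_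
  simp only [norm_mul, Complex.norm_real, norm_neg, Complex.norm_I, one_mul, Real.norm_eq_abs]
  calc _ ≤ ω * B * (γ * |mu g x x' x''|) + ω * B * (γ * |mu g x x' x''|) := by
        gcongr
        · exact hγ.2
        · exact hγ.1
    _ = _ := by ring

/-- Admissibility forces `γ` to be at least the inverse of the increments of the wave. -/
theorem one_le_mul_of_admissible {g : E d → ℂ} {x x' x'' : E d} {γ : ℝ} (hγ0 : 0 < γ)
    (hne : g x ≠ g x'') (hμ : mu g x x' x'' ≠ 0)
    (hγ : max ‖g x - g x'‖ ‖starRingEnd ℂ (g x) - starRingEnd ℂ (g x'')‖ / |mu g x x' x''| ≤ γ) :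
    1 ≤ γ * ‖g x - g x'‖ := by
  have hpos : 0 < |mu g x x' x''| := abs_pos.2 hμ
  rw [div_le_iff₀ hpos, ← map_sub, RCLike.norm_conj, max_le_iff] at hγ
  -- The determinant is at most the product of the two increments, while the numerator of the
  -- quotient is at least the second one; that one cancels.
  have h1 : |mu g x x' x''| ≤ ‖g x - g x'‖ * ‖g x - g x''‖ := by
    rw [mu, abs_neg, ← map_sub]
    refine (Complex.abs_im_le_norm _).trans ?_
    rw [norm_mul, RCLike.norm_conj]
  have h2 : 0 < ‖g x - g x''‖ := norm_pos_iff.2 (sub_ne_zero.2 hne)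
  have h3 : 1 * ‖g x - g x''‖ ≤ γ * ‖g x - g x'‖ * ‖g x - g x''‖ := by
    rw [one_mul, mul_assoc]
    exact hγ.2.trans (mul_le_mul_of_nonneg_left h1 hγ0.le)
  exact le_of_mul_le_mul_right h3 h2

/-! ### Spherical waves and the geometry of the sampling points -/

theorem norm_sphericalWave {b : ℝ} (hb : 0 ≤ b) (ν : ℝ) (x : E d) :
    ‖sphericalWave b ν x‖ = b / ‖x‖ := by
  rw [sphericalWave, norm_mul, mul_comm Complex.I, Complex.norm_exp_ofReal_mul_I, mul_one, norm_div,
    Complex.norm_real, Complex.norm_real, Real.norm_of_nonneg hb, norm_norm]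

theorem norm_le_sum_of_abs_le {x : E d} {b : Fin d → ℝ} (h : ∀ l, |x l| ≤ b l) :
    ‖x‖ ≤ ∑ l, b l := by
  have hb : ∀ l, 0 ≤ b l := fun l => (abs_nonneg _).trans (h l)
  rw [EuclideanSpace.norm_eq]
  refine Real.sqrt_le_iff.2 ⟨Finset.sum_nonneg fun l _ => hb l, ?_⟩
  calc ∑ l, ‖x l‖ ^ 2 ≤ ∑ l, b l ^ 2 := by
        gcongr with l; exact h l
    _ ≤ _ := Finset.sum_sq_le_sq_sum_of_nonneg fun l _ => hb l

/-- The scaled sampling points stay in a fixed ball. -/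
theorem norm_sample_le {Ω : Set (E d)} {M : Fin d → ℝ} (hM : ∀ l, 0 < M l) {N : ℕ}
    {k : Fin d → ℤ} (hk : k ∈ Lam Ω M N) :
    ‖(1 / 2 : ℝ) ^ N • latticePt k‖ ≤ ∑ l, (|(Lmin Ω l : ℝ)| + |(Lmax Ω l : ℝ)| + M l) := by
  refine norm_le_sum_of_abs_le fun l => ?_
  obtain ⟨h1, h2⟩ := mem_Lam.1 hk l
  have hp : (0 : ℝ) < (1 / 2) ^ N := by positivity
  have hp1 : (1 / 2 : ℝ) ^ N ≤ 1 := pow_le_one₀ (by norm_num) (by norm_num)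
  have h3 : (1 / 2 : ℝ) ^ N * 2 ^ N = 1 := by rw [← mul_pow]; norm_num
  have h4 := mul_le_mul_of_nonneg_left h1 hp.le
  have h5 := mul_le_mul_of_nonneg_left h2 hp.le
  rw [mul_sub, ← mul_assoc, h3, one_mul] at h4
  rw [← mul_assoc, h3, one_mul] at h5
  have h6 : (1 / 2 : ℝ) ^ N * M l ≤ M l := by nlinarith [hM l]
  have h7 := neg_abs_le (Lmin Ω l : ℝ)
  have h8 := le_abs_self (Lmax Ω l : ℝ)
  have h9 := abs_nonneg (Lmin Ω l : ℝ)
  have h10 := abs_nonneg (Lmax Ω l : ℝ)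
  have h11 := hM l
  simp only [PiLp.smul_apply, latticePt, smul_eq_mul]
  rw [abs_le]
  constructor <;> linarith

/-- If `0` is not a sampling index, then `Ω` and the scaled sampling points keep a positive
distance from the origin. -/
theorem exists_pos_le_norm {Ω : Set (E d)} {M : Fin d → ℝ} (hM : ∀ l, 0 < M l)
    (hbox : ∀ x ∈ Ω, ∀ l, (Lmin Ω l : ℝ) ≤ x l ∧ x l ≤ (Lmax Ω l : ℝ))
    (h0 : (0 : Fin d → ℤ) ∉ Lam Ω M 1) :
    ∃ ρ : ℝ, 0 < ρ ∧ (∀ x ∈ Ω, ρ ≤ ‖x‖) ∧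
      ∀ N, 1 ≤ N → ∀ k ∈ Lam Ω M N, ρ ≤ ‖(1 / 2 : ℝ) ^ N • latticePt k‖ := by
  rw [mem_Lam] at h0
  push Not at h0
  obtain ⟨l, hl⟩ := h0
  simp only [pow_one, Pi.zero_apply, Int.cast_zero] at hl
  have hcoord : ∀ x : E d, |x l| ≤ ‖x‖ := fun x => PiLp.norm_apply_le x l
  have hsc : ∀ N, ∀ k ∈ Lam Ω M N, (Lmin Ω l : ℝ) - (1 / 2 : ℝ) ^ N * M l ≤
      ((1 / 2 : ℝ) ^ N • latticePt k : E d) l ∧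
      ((1 / 2 : ℝ) ^ N • latticePt k : E d) l ≤ Lmax Ω l := by
    intro N k hk
    obtain ⟨h1, h2⟩ := mem_Lam.1 hk l
    have hp : (0 : ℝ) < (1 / 2) ^ N := by positivity
    have h3 : (1 / 2 : ℝ) ^ N * 2 ^ N = 1 := by rw [← mul_pow]; norm_num
    have h4 := mul_le_mul_of_nonneg_left h1 hp.le
    have h5 := mul_le_mul_of_nonneg_left h2 hp.le
    rw [mul_sub, ← mul_assoc, h3, one_mul] at h4
    rw [← mul_assoc, h3, one_mul] at h5
    simp only [PiLp.smul_apply, latticePt, smul_eq_mul]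
    exact ⟨h4, h5⟩
  have hMl := hM l
  -- Along coordinate `l` the interval `[2 Lmin - M, 2 Lmax]` of level one misses `0`. It lies
  -- either to the left, where `Lmax < 0` gives the gap, or to the right, where the margin `2⁻ᴺ M`
  -- is largest at `N = 1`.
  by_cases hc : 2 * (Lmin Ω l : ℝ) - M l ≤ 0
  · have hneg := hl hc
    refine ⟨-Lmax Ω l, by linarith, fun x hx => ?_, fun N _ k hk => ?_⟩
    · have := neg_abs_le (x l)
      linarith [(hbox x hx l).2, hcoord x]
    · have := neg_abs_le (((1 / 2 : ℝ) ^ N • latticePt k : E d) l)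
      linarith [(hsc N k hk).2, hcoord ((1 / 2 : ℝ) ^ N • latticePt k)]
  · push Not at hc
    refine ⟨Lmin Ω l - 1 / 2 * M l, by linarith, fun x hx => ?_, fun N hN k hk => ?_⟩
    · have := le_abs_self (x l)
      linarith [(hbox x hx l).1, hcoord x]
    · have := le_abs_self (((1 / 2 : ℝ) ^ N • latticePt k : E d) l)
      have h6 : (1 / 2 : ℝ) ^ N ≤ (1 / 2) ^ 1 :=
        pow_le_pow_of_le_one (by norm_num) (by norm_num) hN
      rw [pow_one] at h6
      have h7 := mul_le_mul_of_nonneg_right h6 hMl.le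
      linarith [(hsc N k hk).1, hcoord ((1 / 2 : ℝ) ^ N • latticePt k)]

/-- An integer point of `Ω` is a scaled sampling point at every level. -/
theorem exists_mem_Lam_of_mem_intPoints {Ω : Set (E d)} {M : Fin d → ℝ} (hM : ∀ l, 0 < M l)
    (hbox : ∀ x ∈ Ω, ∀ l, (Lmin Ω l : ℝ) ≤ x l ∧ x l ≤ (Lmax Ω l : ℝ)) {k : Fin d → ℤ}
    (hk : k ∈ intPoints Ω) (N : ℕ) :
    ∃ m ∈ Lam Ω M N, (1 / 2 : ℝ) ^ N • latticePt m = latticePt k := by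
  refine ⟨fun l => 2 ^ N * k l, mem_Lam.2 fun l => ?_, ?_⟩
  · have hp : (0 : ℝ) < 2 ^ N := by positivity
    obtain ⟨h1, h2⟩ := hbox _ hk l
    simp only [latticePt] at h1 h2
    push_cast
    constructor
    · nlinarith [hM l]
    · exact mul_le_mul_of_nonneg_left h2 hp.le
  · ext l
    simp only [latticePt, PiLp.smul_apply, smul_eq_mul]
    push_cast
    rw [← mul_assoc, ← mul_pow]
    norm_num

/-- On `Ω` only translates with index in `Λ_{Ω,N}` contribute. -/
theorem mem_Lam_of_translate_ne_zero {Ω : Set (E d)} {M : Fin d → ℝ} {φ : E d → ℝ}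
    (hbox : ∀ x ∈ Ω, ∀ l, (Lmin Ω l : ℝ) ≤ x l ∧ x l ≤ (Lmax Ω l : ℝ))
    (hsupp : tsupport φ ⊆ {x | ∀ l, 0 ≤ x l ∧ x l ≤ M l}) {x : E d} (hx : x ∈ Ω) {N : ℕ}
    {k : Fin d → ℤ} (hk : φ ((2 : ℝ) ^ N • x - latticePt k) ≠ 0) : k ∈ Lam Ω M N := by
  refine mem_Lam.2 fun l => ?_
  have h1 := hsupp (subset_tsupport _ hk) l
  obtain ⟨h2, h3⟩ := hbox x hx l
  have hp : (0 : ℝ) < 2 ^ N := by positivity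
  have h4 := mul_le_mul_of_nonneg_left h2 hp.le
  have h5 := mul_le_mul_of_nonneg_left h3 hp.le
  simp only [PiLp.sub_apply, PiLp.smul_apply, latticePt, smul_eq_mul] at h1
  constructor <;> linarith [h1.1, h1.2]

/-- Localizes the reconstruction: a sample enters the sum at `x` only if `2ᴺ x - k` lies in the
support box of `φ`. -/
theorem norm_sub_sample_le {M : Fin d → ℝ} {φ : E d → ℝ}
    (hsupp : tsupport φ ⊆ {x | ∀ l, 0 ≤ x l ∧ x l ≤ M l}) {x : E d} {N : ℕ}
    {k : Fin d → ℤ} (hk : φ ((2 : ℝ) ^ N • x - latticePt k) ≠ 0) :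
    ‖x - (1 / 2 : ℝ) ^ N • latticePt k‖ ≤ (1 / 2 : ℝ) ^ N * ∑ l, M l := by
  have h1 := hsupp (subset_tsupport _ hk)
  have h2 : x - (1 / 2 : ℝ) ^ N • latticePt k =
      (1 / 2 : ℝ) ^ N • ((2 : ℝ) ^ N • x - latticePt k) := by
    rw [smul_sub, smul_smul, ← mul_pow]; norm_num
  rw [h2, norm_smul, Real.norm_of_nonneg (by positivity)]
  refine mul_le_mul_of_nonneg_left (norm_le_sum_of_abs_le fun l => ?_) (by positivity)
  rw [abs_of_nonneg (h1 l).1]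
  exact (h1 l).2

/-! ### Averaging and the error of single samples -/

/-- A convex combination of values close to `z` is close to `z`. -/
theorem norm_sub_sum_mul_le {ι : Type*} {s : Finset ι} {w : ι → ℝ} (hw : ∀ i, 0 ≤ w i)
    (hsum : ∑ i ∈ s, w i = 1) {z : ℂ} {r : ι → ℂ} {B : ℝ}
    (h : ∀ i ∈ s, w i ≠ 0 → ‖z - r i‖ ≤ B) : ‖z - ∑ i ∈ s, r i * (w i : ℂ)‖ ≤ B := by
  have h1 : z - ∑ i ∈ s, r i * (w i : ℂ) = ∑ i ∈ s, (z - r i) * (w i : ℂ) := by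
    simp only [sub_mul, Finset.sum_sub_distrib, ← Finset.mul_sum]
    rw [← Complex.ofReal_sum, hsum, Complex.ofReal_one, mul_one]
  rw [h1]
  calc _ ≤ ∑ i ∈ s, B * w i := by
        refine norm_sum_le_of_le _ fun i hi => ?_
        rw [norm_mul, Complex.norm_real, Real.norm_of_nonneg (hw i)]
        by_cases h0 : w i = 0
        · simp [h0]
        · exact mul_le_mul_of_nonneg_right (h i hi h0) (hw i)
    _ = B := by rw [← Finset.mul_sum, hsum, mul_one]

/-- On `Ω` the translates with index in `Λ_{Ω,N}` form a partition of unity. -/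
theorem sum_Lam_translate_eq_one {κ : ℕ} {φ : E d → ℝ} {M : Fin d → ℝ} {A : E d → ℂ}
    (hc : Continuous φ) (hsupp : tsupport φ ⊆ {x | ∀ l, 0 ≤ x l ∧ x l ≤ M l})
    (href : IsRefinable (fun x => (φ x : ℂ)) A) (hA : HasSumRules A (κ + 1)) {Ω : Set (E d)}
    (hbox : ∀ x ∈ Ω, ∀ l, (Lmin Ω l : ℝ) ≤ x l ∧ x l ≤ (Lmax Ω l : ℝ)) (N : ℕ) {x : E d}
    (hx : x ∈ Ω) : ∑ k ∈ Lam Ω M N, φ ((2 : ℝ) ^ N • x - latticePt k) = 1 := by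
  have hcs : HasCompactSupport φ := by
    refine Metric.isCompact_of_isClosed_isBounded (isClosed_tsupport φ) ?_
    refine isBounded_iff_forall_norm_le.2 ⟨∑ l, M l, fun y hy => ?_⟩
    refine norm_le_sum_of_abs_le fun l => ?_
    rw [abs_of_nonneg (hsupp hy l).1]
    exact (hsupp hy l).2
  have h1 := finsum_translate_refinable (φ := fun x => (φ x : ℂ))
    (Complex.continuous_ofReal.comp hc) (hcs.comp_left (g := Complex.ofReal) rfl) href hA
    ((2 : ℝ) ^ N • x)
  rw [finsum_eq_sum_of_support_subset (s := Lam Ω M N)] at h1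
  · exact_mod_cast h1
  · intro k hk
    refine mem_Lam_of_translate_ne_zero hbox hsupp hx (φ := φ) ?_
    simpa using hk

/-- The error of one recovered sample, for a spherical wave whose values at the sampling points
are bounded by `H`. -/
theorem norm_recoveredSample_sub_le {f g : E d → ℂ} {N : ℕ} {k : Fin d → ℤ} {γ H K₀ K₁ R ζ : ℝ}
    {X : Set (E d × E d × E d)} (hadm : IsAdmissible γ g N X)
    (hk : (latticePt k, (1 + (1 / 2 : ℝ) ^ N) • latticePt k,
      (1 - (1 / 2 : ℝ) ^ N) • latticePt k) ∈ X) (hK₁ : 0 ≤ K₁) (hζ : 0 ≤ ζ)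
    (hsup : ∀ y, ‖f y‖ ≤ K₀) (hhol : ∀ y z, ‖f y - f z‖ ≤ K₁ * ‖y - z‖ ^ ζ)
    (hR : ‖(1 / 2 : ℝ) ^ N • latticePt k‖ ≤ R)
    (h' : ‖g ((1 / 2 : ℝ) ^ N • (1 + (1 / 2 : ℝ) ^ N) • latticePt k)‖ ≤ H)
    (h'' : ‖g ((1 / 2 : ℝ) ^ N • (1 - (1 / 2 : ℝ) ^ N) • latticePt k)‖ ≤ H) :
    ‖recoveredSample f g N k - f ((1 / 2 : ℝ) ^ N • latticePt k)‖ ≤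
      γ * (K₁ * ((1 / 2 : ℝ) ^ N * R) ^ ζ * (2 * K₀ + 2 * H)) := by
  obtain ⟨-, -, hμ, hγ⟩ := hadm.2 _ _ _ hk
  set x : E d := (1 / 2 : ℝ) ^ N • latticePt k with hx
  have hp : (0 : ℝ) ≤ (1 / 2) ^ N := by positivity
  -- The perturbed points are `x ± 2⁻ᴺ x`, so the displacement is `2⁻ᴺ ‖x‖`.
  have hd' : ‖x - (1 / 2 : ℝ) ^ N • (1 + (1 / 2 : ℝ) ^ N) • latticePt k‖ ≤ (1 / 2) ^ N * R := by
    have : x - (1 / 2 : ℝ) ^ N • (1 + (1 / 2 : ℝ) ^ N) • latticePt k = -((1 / 2 : ℝ) ^ N • x) := by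
      rw [hx]; module
    rw [this, norm_neg, norm_smul, Real.norm_of_nonneg hp]
    gcongr
  have hd'' : ‖x - (1 / 2 : ℝ) ^ N • (1 - (1 / 2 : ℝ) ^ N) • latticePt k‖ ≤ (1 / 2) ^ N * R := by
    have : x - (1 / 2 : ℝ) ^ N • (1 - (1 / 2 : ℝ) ^ N) • latticePt k = (1 / 2 : ℝ) ^ N • x := by
      rw [hx]; module
    rw [this, norm_smul, Real.norm_of_nonneg hp]
    gcongr
  refine norm_recover_sub_le f g hμ hγ ((hhol _ _).trans ?_) ((hhol _ _).trans ?_) ?_ ?_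
  · gcongr
  · gcongr
  · linarith [hsup x, hsup ((1 / 2 : ℝ) ^ N • (1 + (1 / 2 : ℝ) ^ N) • latticePt k)]
  · linarith [hsup x, hsup ((1 / 2 : ℝ) ^ N • (1 - (1 / 2 : ℝ) ^ N) • latticePt k)]

/-- The modulus of a spherical wave at the perturbed sampling points. -/
theorem norm_sphericalWave_perturbed_le {b ν ρ : ℝ} (hb : 0 < b) (hρ : 0 < ρ) {x : E d}
    (hx : ρ ≤ ‖x‖) {t : ℝ} (ht : 1 / 2 ≤ t) : ‖sphericalWave b ν (t • x)‖ ≤ 2 * b / ρ := by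
  rw [norm_sphericalWave hb.le, norm_smul, Real.norm_of_nonneg (by linarith),
    div_le_div_iff₀ (mul_pos (by linarith) (hρ.trans_le hx)) hρ]
  nlinarith [mul_le_mul ht hx hρ.le (by linarith), norm_nonneg x]

end PhaseRetrieval

open PhaseRetrieval

/-! ### The error estimate -/

theorem theorem4p5 {d : ℕ} (s ς : ℝ) (hs : (d : ℝ) / 2 < s) (hsς : s < ς)
    (κ : ℕ) (hκ : ς < (κ : ℝ) + 1)
    (φ : E d → ℝ) (M : Fin d → ℝ) (A : E d → ℂ)
    (hφ_cont : Continuous φ) (hφ_nonneg : ∀ x, 0 ≤ φ x)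
    (hφ_mem : MemSobolev s (fun x => (φ x : ℂ)))
    (hφ_exp : (ς : EReal) < sobolevExponent (fun x => (φ x : ℂ)))
    (hM : ∀ l, 0 < M l) (hφ_supp : tsupport φ ⊆ {x | ∀ l, 0 ≤ x l ∧ x l ≤ M l})
    (hφ_ref : IsRefinable (fun x => (φ x : ℂ)) A) (hA : HasSumRules A (κ + 1)) :
    ∃ C : ℝ, 0 < C ∧
      ∀ Ω : Set (E d), MeasurableSet Ω → Bornology.IsBounded Ω → (intPoints Ω).Nonempty →
        -- `Ω` lies in the coordinate box spanned by its integer points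
        (∀ x ∈ Ω, ∀ l, (Lmin Ω l : ℝ) ≤ x l ∧ x l ≤ (Lmax Ω l : ℝ)) →
        (∀ N : ℕ, 1 ≤ N → (0 : Fin d → ℤ) ∉ Lam Ω M N) →
        ∃ C₁ : ℝ, 0 < C₁ ∧
          ∀ (γ : ℝ) (a ν : ℕ → ℝ), (∀ N, 1 ≤ N → 0 < a N) →
            IsUniformlyAdmissible γ (fun N => sphericalWave (a N) (ν N)) (fun N => Xi Ω M N) →
            BddAbove {r : ℝ | ∃ j : ℕ, 1 ≤ j ∧ ∃ x ∈ Ω, r = ‖sphericalWave (a j) (ν j) x‖} ∧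
            ∀ f : E d → ℂ, Continuous f → MemSobolev s f → (ς : EReal) < sobolevExponent f →
              ∀ N : ℕ, 1 ≤ N →
                eLpNorm (fun x => f x -
                    reconstruction φ Ω M f (sphericalWave (a N) (ν N)) N x) 2
                    (volume.restrict Ω) ≤
                  ENNReal.ofReal
                    (C * sobolevNorm ς f * (2 : ℝ) ^ (-(N : ℝ) * (ς - s) / 2) +
                      γ * C₁ * sobolevNorm ς f *
                        (sobolevNorm ς f + sSup {r : ℝ | ∃ j : ℕ, 1 ≤ j ∧ ∃ x ∈ Ω,
                          r = ‖sphericalWave (a j) (ν j) x‖}) *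
                        (2 : ℝ) ^ (-(N : ℝ) * min 1 (ς - s))) := by
  -- By admissibility `γ * G` is bounded below in terms of `Ω`, so that the sampling error, which is
  -- of order `2 ^ (-N * ζ)` on `Ω`, is dominated by the second term; every `C > 0` will do.
  refine ⟨1, one_pos, ?_⟩
  intro Ω hΩm hΩb ⟨k₀, hk₀⟩ hbox h0
  obtain ⟨ρ, hρ, hρΩ, hρΛ⟩ := exists_pos_le_norm hM hbox (h0 1 le_rfl)
  -- `ζ ≤ ς - s` leaves `ς - ζ ≥ s > d/2`, as the Hölder embedding requires.
  set ζ := min 1 (ς - s) with hζdef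
  have hζ0 : 0 ≤ ζ := le_min zero_le_one (by linarith)
  have hζ1 : ζ ≤ 1 := min_le_left _ _
  have hζs : ζ ≤ ς - s := min_le_right _ _
  set r₀ := ‖latticePt k₀‖ with hr₀
  have hr₀pos : 0 < r₀ := hρ.trans_le (hρΩ _ hk₀)
  set R := ∑ l, (|(Lmin Ω l : ℝ)| + |(Lmax Ω l : ℝ)| + M l) with hR
  have hR0 : 0 ≤ R := Finset.sum_nonneg fun l _ => by have := hM l; positivity
  set m := ∑ l, M l with hm
  have hm0 : 0 ≤ m := Finset.sum_nonneg fun l _ => (hM l).le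
  set K₀ := sobolevConst d ς with hK₀
  set K₁ := 2 * sobolevConst d (ς - ζ) with hK₁
  have hK₀0 : 0 ≤ K₀ := Real.sqrt_nonneg _
  have hK₁0 : 0 ≤ K₁ := mul_nonneg zero_le_two (Real.sqrt_nonneg _)
  -- `D * G` will bound the wave at all sampling points: the amplitude is at most `r₀ * G`, and
  -- these points have norm at least `ρ / 2`.
  set D := 2 * r₀ / ρ with hD
  have hD0 : 0 ≤ D := by positivity
  -- The first summand pays for replacing `f x` by nearby samples, after multiplication by `γ * (2 *
  -- (D * G)) ≥ 1`; the second pays for the recovery error.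
  set K := 2 * K₁ * m ^ ζ * D + 2 * K₁ * R ^ ζ * (K₀ + D) with hK
  have hK0 : 0 ≤ K := by positivity
  set V := (volume Ω).toReal ^ (2 : ℝ)⁻¹ with hV
  have hV0 : 0 ≤ V := by positivity
  -- Adding `1` keeps the constant positive even when `Ω` is a null set.
  refine ⟨V * K + 1, by positivity, ?_⟩
  intro γ a ν ha hadm
  -- The integer point `k₀` is a scaled sampling point at every level, so the uniform bound there
  -- controls all amplitudes, and `‖x‖ ≥ ρ` on `Ω`.
  have hbdd : BddAbove {r : ℝ | ∃ j : ℕ, 1 ≤ j ∧ ∃ x ∈ Ω, r = ‖sphericalWave (a j) (ν j) x‖} := by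
    obtain ⟨B, hB⟩ := hadm.2
    refine ⟨r₀ * B / ρ, ?_⟩
    rintro _ ⟨j, hj, x, hx, rfl⟩
    obtain ⟨k, hk, hkk₀⟩ := exists_mem_Lam_of_mem_intPoints hM hbox hk₀ j
    have h1 := (hB j hj _ _ _ ⟨k, hk, rfl⟩).1
    rw [hkk₀, norm_sphericalWave (ha j hj).le, div_le_iff₀ hr₀pos] at h1
    rw [norm_sphericalWave (ha j hj).le]
    have := ha j hj
    exact div_le_div₀ (by linarith) (by linarith) hρ (hρΩ x hx)
  refine ⟨hbdd, ?_⟩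
  intro f hf _ hfς N hN
  set G := sSup {r : ℝ | ∃ j : ℕ, 1 ≤ j ∧ ∃ x ∈ Ω, r = ‖sphericalWave (a j) (ν j) x‖} with hG
  set n := sobolevNorm ς f with hn
  have hn0 : 0 ≤ n := sobolevNorm_nonneg ς f
  have hmem : MemSobolev ς f := memSobolev_of_lt_sobolevExponent hfς
  have hsup : ∀ y, ‖f y‖ ≤ n * K₀ := hmem.norm_le hf (by linarith)
  have hhol : ∀ y z, ‖f y - f z‖ ≤ K₁ * n * ‖y - z‖ ^ ζ := fun y z =>
    (hmem.norm_sub_le hf hζ0 hζ1 (by linarith) y z).trans (le_of_eq (by ring))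
  have haN := ha N hN
  have haG : a N ≤ r₀ * G := by
    have h1 : ‖sphericalWave (a N) (ν N) (latticePt k₀)‖ ≤ G :=
      le_csSup hbdd ⟨N, hN, _, hk₀, rfl⟩
    rw [norm_sphericalWave haN.le, div_le_iff₀ hr₀pos] at h1
    linarith
  have hG0 : 0 ≤ G := by
    by_contra hneg
    nlinarith
  have hH : ∀ k ∈ Lam Ω M N, ∀ t : ℝ, 1 / 2 ≤ t →
      ‖sphericalWave (a N) (ν N) (t • (1 / 2 : ℝ) ^ N • latticePt k)‖ ≤ D * G := by
    intro k hk t ht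
    refine (norm_sphericalWave_perturbed_le haN hρ (hρΛ N hN k hk) ht).trans ?_
    rw [hD, div_mul_eq_mul_div]
    exact div_le_div_of_nonneg_right (by linarith) hρ.le
  have hpow1 : (1 / 2 : ℝ) ^ N ≤ 1 / 2 := by
    simpa using pow_le_pow_of_le_one (a := (1 / 2 : ℝ)) (by norm_num) (by norm_num) hN
  have hpow0 : (0 : ℝ) < (1 / 2) ^ N := by positivity
  have hγ0 := (hadm.1 N hN).1
  set θ := (2 : ℝ) ^ (-(N : ℝ) * ζ) with hθ
  have hθ0 : 0 ≤ θ := by positivity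
  have hscale : ∀ t : ℝ, 0 ≤ t → ((1 / 2 : ℝ) ^ N * t) ^ ζ = θ * t ^ ζ := by
    intro t ht
    rw [Real.mul_rpow hpow0.le ht, hθ, Real.rpow_mul zero_le_two, Real.rpow_neg zero_le_two,
      Real.rpow_natCast, one_div, inv_pow]
  have hpoint : ∀ x ∈ Ω, ‖f x - reconstruction φ Ω M f (sphericalWave (a N) (ν N)) N x‖ ≤
      γ * K * n * (n + G) * θ := by
    intro x hx
    refine norm_sub_sum_mul_le (fun k => hφ_nonneg _)
      (sum_Lam_translate_eq_one hφ_cont hφ_supp hφ_ref hA hbox N hx) fun k hk hne => ?_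
    have hXi : (latticePt k, (1 + (1 / 2 : ℝ) ^ N) • latticePt k,
        (1 - (1 / 2 : ℝ) ^ N) • latticePt k) ∈ Xi Ω M N := ⟨k, hk, rfl⟩
    have g1 := hH k hk 1 (by norm_num)
    have g2 := hH k hk (1 + (1 / 2 : ℝ) ^ N) (by linarith)
    have g3 := hH k hk (1 - (1 / 2 : ℝ) ^ N) (by linarith)
    rw [one_smul] at g1
    rw [smul_comm] at g2 g3
    have e1 : ‖f x - f ((1 / 2 : ℝ) ^ N • latticePt k)‖ ≤ K₁ * n * (θ * m ^ ζ) := by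
      refine (hhol _ _).trans ?_
      rw [← hscale m hm0]
      gcongr
      exact norm_sub_sample_le hφ_supp hne
    -- The decisive inequality: it supplies the factor `γ * G` that the approximation error lacks.
    have e2 : 1 ≤ γ * (2 * (D * G)) := by
      obtain ⟨-, hne'', hμ, hγ⟩ := (hadm.1 N hN).2 _ _ _ hXi
      refine (one_le_mul_of_admissible hγ0 hne'' hμ hγ).trans ?_
      gcongr
      refine (norm_sub_le _ _).trans ?_
      linarith
    have e3 := norm_recoveredSample_sub_le (hadm.1 N hN) hXi (by positivity) hζ0 hsup hhol
      (norm_sample_le hM hk) g2 g3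
    rw [← hR, hscale R hR0] at e3
    have e4 : K₁ * n * (θ * m ^ ζ) ≤ K₁ * n * (θ * m ^ ζ) * (γ * (2 * (D * G))) :=
      le_mul_of_one_le_right (by positivity) e2
    have e5 := norm_sub_le_norm_sub_add_norm_sub (f x) (f ((1 / 2 : ℝ) ^ N • latticePt k))
      (recoveredSample f (sphericalWave (a N) (ν N)) N k)
    rw [norm_sub_rev (f ((1 / 2 : ℝ) ^ N • latticePt k))] at e5
    -- The target exceeds the two error bounds by the last summand, which is nonnegative.
    have e6 : γ * K * n * (n + G) * θ = K₁ * n * (θ * m ^ ζ) * (γ * (2 * (D * G))) +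
        γ * (K₁ * n * (θ * R ^ ζ) * (2 * (n * K₀) + 2 * (D * G))) +
        γ * n * θ * (2 * K₁ * m ^ ζ * D * n + 2 * K₁ * R ^ ζ * (K₀ * G + D * n)) := by
      rw [hK]; ring
    have e7 : 0 ≤ γ * n * θ *
        (2 * K₁ * m ^ ζ * D * n + 2 * K₁ * R ^ ζ * (K₀ * G + D * n)) := by positivity
    linarith
  have hvol : volume Ω ≠ ⊤ := hΩb.measure_lt_top.ne
  -- The uniform bound on `Ω` costs a factor `√(volume Ω)` in `L²`; the first term of the claimed
  -- estimate is only used to be nonnegative.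
  refine (eLpNorm_le_of_ae_bound (ae_restrict_of_forall_mem hΩm hpoint)).trans ?_
  rw [Measure.restrict_apply_univ, ENNReal.toReal_ofNat, ← ENNReal.ofReal_toReal hvol,
    ENNReal.ofReal_rpow_of_nonneg ENNReal.toReal_nonneg (by norm_num),
    ← ENNReal.ofReal_mul (by positivity)]
  refine ENNReal.ofReal_le_ofReal ?_
  have f1 : 0 ≤ 1 * n * (2 : ℝ) ^ (-(N : ℝ) * (ς - s) / 2) := by positivity
  have f2 : 0 ≤ γ * n * (n + G) * θ := by positivity
  calc V * (γ * K * n * (n + G) * θ) = V * K * (γ * n * (n + G) * θ) := by ring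
    _ ≤ (V * K + 1) * (γ * n * (n + G) * θ) := by linarith
    _ ≤ _ := by linarith
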